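/- Let $\sigma>0$ and $A\in\mathbb R$. Let $\theta=\{\theta_t\}_{t\in\mathbb Z}$ be a stationary, zero-mean Gaussian process whose covariances $r_k=E[\theta_0\theta_k]$ are absolutely summable, with spectral density $\Sigma_\theta(\omega)=\sum_{k=-\infty}^{\infty}r_ke^{-ik\omega}$. For each blocklength $n$ let a codebook $\mathcal C_n$ of $M_n$ codewords in $\mathbb R^n$ be given, deterministic or random, together with a message $m$ that is uniform on the $M_n$ messages and independent of $\mathcal C_n$. Let $X=(X_1,\dots,X_n)$ be the codeword of $m$, and assume $|X_t|\le A$ almost surely for $t=1,\dots,n$. Let $Y=(Y_1,\dots,Y_n)$ be the channel output. An arbitrary measurable decoder (for instance, a metric decoder) computes $\hat m$ from $\mathcal C_n$ and $Y$, and $\mathcal E_n=\{\hat m\neq m\}$ is the error event. Consider two probability measures $P$ and $Q$. * Under $P$ (fading), $Y_t=(1+\theta_t)X_t+W_t$, where $W_1,\dots,W_n$ are i.i.d. $\mathcal N(0,\sigma^2)$ and $(\mathcal C_n,m)$, $\theta$ and $W$ are mutually independent. * Under $Q$ (no fading), $Y_t=X_t+\tilde W_t$, where the joint law of $(\mathcal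 C_n,m,\theta,\tilde W)$ under $Q$ equals that of $(\mathcal C_n,m,\theta,W)$ under $P$. For $\hat P\in\{P,Q\}$ define, with values in $[0,\infty]$ and with $\ln 0=-\infty$, $$E_*(\hat P)=-\limsup_{n\to\infty}\frac1n\ln\hat P(\mathcal E_n),\qquad E^*(\hat P)=-\liminf_{n\to\infty}\frac1n\ln\hat P(\mathcal E_n).$$ Let $\alpha>1$ and $c=\alpha(\alpha-1)A^2/(2\sigma^2)$, and assume $2c\,\sup_\omega\Sigma_\theta(\omega)<1$. Then $$E(P)\le\frac{\alpha}{\alpha-1}E(Q)-\frac{1}{4\pi(\alpha-1)}\int_0^{2\pi}\ln[1-2c\,\Sigma_\theta(\omega)]\,d\omega,$$ $$E(P)\ge\frac{\alpha-1}{\alpha}E(Q)+\frac{1}{4\pi\alpha}\int_0^{2\pi}\ln[1-2c\,\Sigma_\theta(\omega)]\,d\omega,$$ where both inequalities hold with $E=E^*$ on both sides and also with $E=E_*$ on both sides. In particular they hold for the limits $E(P)$ and $E(Q)$ of $-\frac1n\ln P(\mathcal E_n)$ and $-\frac1n\ln Q(\mathcal E_n)$ whenever these limits exist. -/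

import Mathlib

open MeasureTheory ProbabilityTheory Filter
open scoped ENNReal

/-- `E^*`: minus the lower limit of `(1/n) ln p_n`, with `ln 0 = -∞`. -/
noncomputable def upperExponent (p : ℕ → ℝ≥0∞) : EReal :=
  -liminf (fun n : ℕ => ((1 / (n : ℝ) : ℝ) : EReal) * ENNReal.log (p n)) atTop

/-- `E_*`: minus the upper limit of `(1/n) ln p_n`, with `ln 0 = -∞`. When
`-(1/n) ln p_n` has a limit `E` in `[-∞, ∞]`, both exponents are equal to `E`. -/
noncomputable def lowerExponent (p : ℕ → ℝ≥0∞) : EReal :=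
  -limsup (fun n : ℕ => ((1 / (n : ℝ) : ℝ) : EReal) * ENNReal.log (p n)) atTop

/-- A codebook with `M` real codewords of length `n`. -/
abbrev Codebook (M n : ℕ) : Type := Fin M → Fin n → ℝ

/-- The autocovariance `r_k = E[θ_0 θ_k]` of a zero-mean stationary process. -/
noncomputable def autocov {Ω : Type*} [MeasurableSpace Ω] (P : Measure Ω)
    (θ : ℤ → Ω → ℝ) (k : ℤ) : ℝ :=
  ∫ ω, θ 0 ω * θ k ω ∂P

/-- The spectral density `Σ_k r_k e^{-ikλ}` of a real covariance sequence. The series is real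
because `r_{-k} = r_k`. -/
noncomputable def spectralDensity (r : ℤ → ℝ) (lam : ℝ) : ℝ :=
  (∑' k : ℤ, (r k : ℂ) * Complex.exp (-(Complex.I * (k : ℂ) * (lam : ℂ)))).re

/-- A stationary zero-mean Gaussian process indexed by `ℤ`. -/
structure IsStationaryGaussian {Ω : Type*} [MeasurableSpace Ω] (P : Measure Ω)
    (θ : ℤ → Ω → ℝ) : Prop where
  measurable : ∀ t, Measurable (θ t)
  gaussian : IsGaussianProcess θ P
  zero_mean : ∀ t, ∫ ω, θ t ω ∂P = 0
  stationary : ∀ s : ℤ,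
    P.map (fun ω => fun t : ℤ => θ (t + s) ω) = P.map (fun ω => fun t : ℤ => θ t ω)

section Channel

variable {Ω : Type*} {M n : ℕ}

/-- The transmitted vector `X = x_m`, the codeword of the message `m` in the codebook. -/
def input (C : Ω → Codebook M n) (m : Ω → Fin M) (ω : Ω) : Fin n → ℝ :=
  C ω (m ω)

/-- The noise `Y_t - (1 + θ_t) X_t` of the channel with fading, `t = 1, …, n`. The coordinate
`i : Fin n` stands for the time `t = i + 1`. -/
def fadingNoise (C : Ω → Codebook M n) (m : Ω → Fin M) (θ : ℤ → Ω → ℝ)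
    (Y : Ω → Fin n → ℝ) (ω : Ω) : Fin n → ℝ :=
  fun i => Y ω i - (1 + θ ((i : ℕ) + 1 : ℤ) ω) * input C m ω i

/-- The noise `Y_t - X_t` of the channel without fading. -/
def plainNoise (C : Ω → Codebook M n) (m : Ω → Fin M)
    (Y : Ω → Fin n → ℝ) (ω : Ω) : Fin n → ℝ :=
  fun i => Y ω i - input C m ω i

/-- Under `P`, transmission over `Y_t = (1 + θ_t) X_t + W_t` at blocklength `n`, with a possibly
random codebook `C` and a uniform message `m` that is independent of it: the amplitude of the
input is at most `A`, the noise is i.i.d. `N(0, σ²)`, and the transmitter `(C, m)`, the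
fading `θ` and the noise are mutually independent. -/
structure IsFadingChannel [MeasurableSpace Ω] (P : Measure Ω) (σ A : ℝ)
    (C : Ω → Codebook M n) (m : Ω → Fin M) (θ : ℤ → Ω → ℝ) (Y : Ω → Fin n → ℝ) : Prop where
  measurable_code : Measurable C
  measurable_message : Measurable m
  measurable_output : Measurable Y
  message_uniform : ∀ j : Fin M, P (m ⁻¹' {j}) = (M : ℝ≥0∞)⁻¹
  indep_code_message : IndepFun C m P
  amplitude : ∀ᵐ ω ∂P, ∀ i, |input C m ω i| ≤ A
  noise_law : P.map (fadingNoise C m θ Y)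
    = Measure.pi (fun _ : Fin n => gaussianReal 0 (σ ^ 2).toNNReal)
  indep_transmitter : IndepFun (fun ω => (C ω, m ω))
    (fun ω => ((fun t : ℤ => θ t ω), fadingNoise C m θ Y ω)) P
  indep_fading_noise : IndepFun (fun ω => fun t : ℤ => θ t ω) (fadingNoise C m θ Y) P

/-- Under `Q`, the same transmission over the channel `Y_t = X_t + W̃_t` without fading: the
joint law of codebook, message, `θ` and `W̃` under `Q` is that of codebook, message, `θ` and `W`
under `P`. -/
def IsNoFadingReference [MeasurableSpace Ω] (P Q : Measure Ω)
    (C : Ω → Codebook M n) (m : Ω → Fin M) (θ : ℤ → Ω → ℝ) (Y : Ω → Fin n → ℝ) : Prop :=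
  IdentDistrib
    (fun ω => (C ω, m ω, (fun t : ℤ => θ t ω), plainNoise C m Y ω))
    (fun ω => (C ω, m ω, (fun t : ℤ => θ t ω), fadingNoise C m θ Y ω)) Q P

/-- The error event: the message that the decoder finds from the codebook and the channel output
is not the one that was sent. -/
def errorEvent (dec : Codebook M n → (Fin n → ℝ) → Fin M)
    (C : Ω → Codebook M n) (m : Ω → Fin M) (Y : Ω → Fin n → ℝ) : Set Ω :=
  {ω | dec (C ω) (Y ω) ≠ m ω}

end Channel

/-! Conditionally on codebook, message and fading, the two channels differ only by the deterministic
shift `h_t = θ_t X_t` of the Gaussian noise. Let `L` be the density of `N(h, σ² I)` with respect to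
`N(0, σ² I)`. Writing `P(E)` as the integral of `L` over the error set of the channel without
fading, Hölder with exponents `α` and `α/(α-1)` gives `P(E) ≤ (∫ L^α)^(1/α) Q(E)^((α-1)/α)`
(`measure_gaussian_shift_le`). The shift `-h` gives the same bound with `P` and `Q` exchanged.

The inner Gaussian integral of `L^α` is `exp(α(α-1)/(2σ²) ∑ h_t²)`, and `|X_t| ≤ A` reduces its mean
to `E exp(c ∑ θ_t²)`. Linearising the square with an auxiliary standard Gaussian vector turns this
into a Gaussian integral whose matrix is the Toeplitz matrix of `1 - 2cΣ`, that is, its determinant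
to the power `-1/2`. Every pivot of that matrix is at least the geometric mean of `1 - 2cΣ`: a pivot
is the weighted mean square of a monic polynomial on the circle, and Jensen's inequality together
with Mahler measure at least `1` bounds it below (`exp_average_log_le_average_norm_sq_mul`). This
makes the moment bound exact for every `n`, with no asymptotics (`lintegral_exp_mul_sum_sq_le`).

Dividing logarithms by `n` gives the lower bounds on the exponents of `P`; the exchanged inequality,
solved for the exponents of `P`, gives the upper bounds. -/

/-! ### Gaussian noise, its shifts, and the Hölder bound. -/

theorem lintegral_fin_pi_prod_eq_prod {n : ℕ} (μ : Fin n → Measure ℝ) [∀ i, SigmaFinite (μ i)]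
    {f : Fin n → ℝ → ℝ≥0∞} (hf : ∀ i, Measurable (f i)) :
    ∫⁻ x, ∏ i, f i (x i) ∂(Measure.pi μ) = ∏ i, ∫⁻ x, f i x ∂(μ i) := by
  induction n with
  | zero => simp
  | succ n ih =>
    have hmp := (measurePreserving_piFinSuccAbove μ 0).symm
    rw [← hmp.lintegral_comp_emb (MeasurableEquiv.measurableEmbedding _)]
    simp only [Fin.prod_univ_succ, Fin.zero_succAbove, MeasurableEquiv.piFinSuccAbove_symm_apply,
      Fin.insertNthEquiv_apply, Fin.insertNth_zero, Fin.cons_zero, Fin.cons_succ]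
    simp only [cast_eq]
    rw [lintegral_prod_mul (f := f 0) (g := fun y : Fin n → ℝ => ∏ i, f i.succ (y i))
      (hf 0).aemeasurable (Finset.measurable_prod _ fun i _ =>
        (hf i.succ).comp (measurable_pi_apply i)).aemeasurable, ih _ fun i => hf _]

theorem pi_gaussianReal_eq_withDensity (n : ℕ) {v : NNReal} (hv : v ≠ 0) :
    Measure.pi (fun _ : Fin n => gaussianReal 0 v)
      = volume.withDensity (fun w : Fin n → ℝ => ∏ i, gaussianPDF 0 v (w i)) := by
  refine Measure.pi_eq fun s hs => ?_
  rw [withDensity_apply _ (MeasurableSet.univ_pi hs), ← lintegral_indicator (MeasurableSet.univ_pi hs)]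
  have h : (Set.univ.pi s).indicator (fun w : Fin n → ℝ => ∏ i, gaussianPDF 0 v (w i))
      = fun w => ∏ i, (s i).indicator (gaussianPDF 0 v) (w i) := by
    ext w
    by_cases hw : w ∈ Set.univ.pi s
    · rw [Set.indicator_of_mem hw]
      exact Finset.prod_congr rfl fun i _ => (Set.indicator_of_mem (hw i trivial) _).symm
    · rw [Set.indicator_of_notMem hw]
      simp only [Set.mem_pi, not_forall] at hw
      obtain ⟨i, _, hi⟩ := hw
      exact (Finset.prod_eq_zero (Finset.mem_univ i) (Set.indicator_of_notMem hi _)).symm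
  rw [h, volume_pi, lintegral_fin_pi_prod_eq_prod _
    fun i => (measurable_gaussianPDF 0 v).indicator (hs i)]
  refine Finset.prod_congr rfl fun i _ => ?_
  rw [lintegral_indicator (hs i), gaussianReal_apply _ hv]

/-- The density of `N(h, v I)` with respect to `N(0, v I)`. -/
noncomputable def gaussianShiftDensity {n : ℕ} (v : ℝ) (h w : Fin n → ℝ) : ℝ :=
  Real.exp (∑ i, (h i * w i / v - h i ^ 2 / (2 * v)))

/-- Completing the square: tilting by the `a`-th power of the shift density moves the mean to `a h`,
up to a constant. The case `a = 1` is the change of variables, and general `a` gives the Rényi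
moment. -/
theorem prod_gaussianPDF_sub_smul {n : ℕ} {v : NNReal} (hv : v ≠ 0) (a : ℝ) (h w : Fin n → ℝ) :
    ENNReal.ofReal (Real.exp (a * (a - 1) / (2 * v) * ∑ i, h i ^ 2)) *
        ∏ i, gaussianPDF 0 v (w i - a * h i)
      = ENNReal.ofReal (gaussianShiftDensity v h w ^ a) * ∏ i, gaussianPDF 0 v (w i) := by
  have hv' : (v : ℝ) ≠ 0 := by exact_mod_cast hv
  simp only [gaussianPDF]
  rw [← ENNReal.ofReal_prod_of_nonneg fun i _ => gaussianPDFReal_nonneg _ _ _,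
    ← ENNReal.ofReal_prod_of_nonneg fun i _ => gaussianPDFReal_nonneg _ _ _,
    ← ENNReal.ofReal_mul (by positivity), ← ENNReal.ofReal_mul
      (by unfold gaussianShiftDensity; positivity)]
  congr 1
  simp only [gaussianPDFReal, gaussianShiftDensity, Finset.prod_mul_distrib, ← Real.exp_sum]
  rw [← Real.exp_mul, mul_left_comm, mul_left_comm (Real.exp _), ← Real.exp_add, ← Real.exp_add]
  congr 2
  rw [Finset.mul_sum, Finset.sum_mul, ← Finset.sum_add_distrib, ← Finset.sum_add_distrib]
  refine Finset.sum_congr rfl fun i _ => ?_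
  field_simp
  ring

theorem measurable_gaussianShiftDensity {n : ℕ} (v : ℝ) {T : Type*} [MeasurableSpace T]
    {h : T → Fin n → ℝ} (hh : Measurable h) :
    Measurable fun z : T × (Fin n → ℝ) => gaussianShiftDensity v (h z.1) z.2 := by
  unfold gaussianShiftDensity
  fun_prop

theorem lintegral_pi_gaussianReal {n : ℕ} {v : NNReal} (hv : v ≠ 0) {F : (Fin n → ℝ) → ℝ≥0∞}
    (hF : Measurable F) :
    ∫⁻ w, F w ∂(Measure.pi fun _ : Fin n => gaussianReal 0 v)
      = ∫⁻ w, (∏ i, gaussianPDF 0 v (w i)) * F w := by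
  have : Measurable (fun w : Fin n → ℝ => ∏ i, gaussianPDF 0 v (w i)) :=
    Finset.measurable_prod _ fun i _ => (measurable_gaussianPDF 0 v).comp (measurable_pi_apply i)
  rw [pi_gaussianReal_eq_withDensity n hv, lintegral_withDensity_eq_lintegral_mul _ this hF]
  rfl

/-- The Gaussian change of variables `w ↦ w + h`. -/
theorem lintegral_pi_gaussianReal_add {n : ℕ} {v : NNReal} (hv : v ≠ 0)
    {F : (Fin n → ℝ) → ℝ≥0∞} (hF : Measurable F) (h : Fin n → ℝ) :
    ∫⁻ w, F (w + h) ∂(Measure.pi fun _ : Fin n => gaussianReal 0 v)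
      = ∫⁻ w, ENNReal.ofReal (gaussianShiftDensity v h w) * F w
          ∂(Measure.pi fun _ : Fin n => gaussianReal 0 v) := by
  have hm : Measurable fun w : Fin n → ℝ => gaussianShiftDensity v h w := by
    unfold gaussianShiftDensity; fun_prop
  rw [lintegral_pi_gaussianReal hv (by fun_prop), lintegral_pi_gaussianReal hv (by fun_prop),
    ← lintegral_sub_right_eq_self _ h]
  refine lintegral_congr fun w => ?_
  have := prod_gaussianPDF_sub_smul hv 1 h w
  simp only [sub_self, mul_zero, zero_div, zero_mul, Real.exp_zero, ENNReal.ofReal_one, one_mul,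
    Real.rpow_one] at this
  simp only [sub_add_cancel, Pi.sub_apply]
  rw [this]
  ring

theorem lintegral_gaussianShiftDensity_rpow {n : ℕ} {v : NNReal} (hv : v ≠ 0) (a : ℝ)
    (h : Fin n → ℝ) :
    ∫⁻ w, ENNReal.ofReal (gaussianShiftDensity v h w ^ a)
        ∂(Measure.pi fun _ : Fin n => gaussianReal 0 v)
      = ENNReal.ofReal (Real.exp (a * (a - 1) / (2 * v) * ∑ i, h i ^ 2)) := by
  have hm : Measurable fun w : Fin n → ℝ => gaussianShiftDensity v h w := by
    unfold gaussianShiftDensity; fun_prop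
  have hp : Measurable fun w : Fin n → ℝ => ∏ i, gaussianPDF 0 v (w i) :=
    Finset.measurable_prod _ fun i _ => (measurable_gaussianPDF 0 v).comp (measurable_pi_apply i)
  rw [lintegral_pi_gaussianReal hv (by fun_prop)]
  simp only [mul_comm (∏ i, gaussianPDF 0 v _), ← prod_gaussianPDF_sub_smul hv a h]
  rw [lintegral_const_mul' _ _ ENNReal.ofReal_ne_top]
  -- The remaining integral is that of a translated Gaussian density, hence the total mass `1`.
  have := lintegral_sub_right_eq_self (μ := volume)
    (fun w : Fin n → ℝ => ∏ i, gaussianPDF 0 v (w i)) (a • h)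
  simp only [Pi.sub_apply, Pi.smul_apply, smul_eq_mul] at this
  rw [this]
  have h1 := lintegral_pi_gaussianReal (n := n) hv (F := fun _ => 1) measurable_const
  simp only [lintegral_const, measure_univ, mul_one] at h1
  rw [← h1, mul_one]

/-- A random shift `h` of Gaussian noise changes probabilities by at most the Rényi divergence
factor. -/
theorem measure_gaussian_shift_le {n : ℕ} {v : NNReal} (hv : v ≠ 0) {T : Type*}
    [MeasurableSpace T] (τ : Measure T) [SFinite τ] {h : T → Fin n → ℝ} (hh : Measurable h)
    {B : Set (T × (Fin n → ℝ))} (hB : MeasurableSet B) {a : ℝ} (ha : 1 < a) :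
    (τ.prod (Measure.pi fun _ : Fin n => gaussianReal 0 v)) {z | (z.1, z.2 + h z.1) ∈ B}
      ≤ (∫⁻ t, ENNReal.ofReal (Real.exp (a * (a - 1) / (2 * v) * ∑ i, h t i ^ 2)) ∂τ) ^ (1 / a)
        * (τ.prod (Measure.pi fun _ : Fin n => gaussianReal 0 v)) B ^ ((a - 1) / a) := by
  set γ := Measure.pi fun _ : Fin n => gaussianReal 0 v with hγ
  have hL := measurable_gaussianShiftDensity (v : ℝ) hh
  have hLa : Measurable fun z : T × (Fin n → ℝ) =>
      ENNReal.ofReal (gaussianShiftDensity v (h z.1) z.2 ^ a) :=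
    (hL.pow_const a).ennreal_ofReal
  have ha0 : 0 < a := by linarith
  have hB' : MeasurableSet {z : T × (Fin n → ℝ) | (z.1, z.2 + h z.1) ∈ B} :=
    hB.preimage (by fun_prop)
  have h1 : (τ.prod γ) {z | (z.1, z.2 + h z.1) ∈ B}
      = ∫⁻ z, ENNReal.ofReal (gaussianShiftDensity v (h z.1) z.2) * B.indicator 1 z
          ∂(τ.prod γ) := by
    have hi : Measurable (B.indicator (1 : T × (Fin n → ℝ) → ℝ≥0∞)) :=
      measurable_one.indicator hB
    rw [← lintegral_indicator_one hB', lintegral_prod _ (measurable_one.indicator hB').aemeasurable,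
      lintegral_prod _ (by fun_prop)]
    refine lintegral_congr fun t => ?_
    exact lintegral_pi_gaussianReal_add hv (F := fun w => B.indicator 1 (t, w)) (by fun_prop) (h t)
  have h2 : ∫⁻ z, ENNReal.ofReal (gaussianShiftDensity v (h z.1) z.2 ^ a) ∂(τ.prod γ)
      = ∫⁻ t, ENNReal.ofReal (Real.exp (a * (a - 1) / (2 * v) * ∑ i, h t i ^ 2)) ∂τ := by
    rw [lintegral_prod _ hLa.aemeasurable]
    exact lintegral_congr fun t => lintegral_gaussianShiftDensity_rpow hv a (h t)
  rw [h1, ← h2]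
  have hpos : 0 < (a - 1) / a := div_pos (by linarith) ha0
  -- Hölder in the form `∫ f^p g^q ≤ (∫ f)^p (∫ g)^q` with `p + q = 1`. Here `f` is the `a`-th power
  -- of the density, so `f^p` is the density itself, and an indicator is unchanged by a positive
  -- power.
  have h3 := ENNReal.lintegral_mul_norm_pow_le (μ := τ.prod γ)
    (f := fun z => ENNReal.ofReal (gaussianShiftDensity v (h z.1) z.2 ^ a))
    (g := B.indicator 1) (p := 1 / a) (q := (a - 1) / a) hLa.aemeasurable
    (measurable_one.indicator hB).aemeasurable (by positivity) hpos.le (by field_simp; ring)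
  rw [lintegral_indicator_one hB] at h3
  refine (lintegral_congr fun z => ?_).trans_le h3
  congr 1
  · have : 0 ≤ gaussianShiftDensity v (h z.1) z.2 := (Real.exp_pos _).le
    rw [ENNReal.ofReal_rpow_of_nonneg (by positivity) (by positivity), ← Real.rpow_mul this,
      mul_one_div_cancel ha0.ne', Real.rpow_one]
  · by_cases hz : z ∈ B
    · simp [hz]
    · simp [hz, hpos]

/-! ### Fourier series of the spectral density and Toeplitz quadratic forms. -/

section Spectral

variable {r : ℤ → ℝ}

theorem norm_spectral_term (r : ℤ → ℝ) (k : ℤ) (x : ℝ) :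
    ‖(r k : ℂ) * Complex.exp (-(Complex.I * (k : ℂ) * (x : ℂ)))‖ = |r k| := by
  have : -(Complex.I * (k : ℂ) * (x : ℂ)) = ((-(k * x) : ℝ) : ℂ) * Complex.I := by
    push_cast; ring
  rw [norm_mul, this, Complex.norm_exp_ofReal_mul_I, mul_one, Complex.norm_real, Real.norm_eq_abs]

theorem summable_spectral_term (hr : Summable fun k => |r k|) (x : ℝ) :
    Summable fun k : ℤ => (r k : ℂ) * Complex.exp (-(Complex.I * (k : ℂ) * (x : ℂ))) :=
  Summable.of_norm (by simpa only [norm_spectral_term] using hr)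

theorem continuous_spectral_series (hr : Summable fun k => |r k|) :
    Continuous fun x : ℝ =>
      ∑' k : ℤ, (r k : ℂ) * Complex.exp (-(Complex.I * (k : ℂ) * (x : ℂ))) :=
  continuous_tsum (fun k => by fun_prop) hr fun k x => (norm_spectral_term r k x).le

theorem continuous_spectralDensity (hr : Summable fun k => |r k|) :
    Continuous (spectralDensity r) :=
  Complex.continuous_re.comp (continuous_spectral_series hr)

theorem spectralDensity_le (hr : Summable fun k => |r k|) (x : ℝ) :
    spectralDensity r x ≤ ∑' k, |r k| := by
  refine (Complex.re_le_norm _).trans ?_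
  refine (norm_tsum_le_tsum_norm (by simpa only [norm_spectral_term] using hr)).trans_eq ?_
  simp only [norm_spectral_term]

theorem bddAbove_spectralDensity (hr : Summable fun k => |r k|) :
    BddAbove (Set.range (spectralDensity r)) :=
  ⟨_, Set.forall_mem_range.2 (spectralDensity_le hr)⟩

theorem ofReal_spectralDensity (hsymm : ∀ k, r (-k) = r k) (x : ℝ) :
    (spectralDensity r x : ℂ)
      = ∑' k : ℤ, (r k : ℂ) * Complex.exp (-(Complex.I * (k : ℂ) * (x : ℂ))) := by
  refine Complex.conj_eq_iff_re.1 ?_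
  rw [Complex.conj_tsum, ← (Equiv.neg ℤ).tsum_eq]
  refine tsum_congr fun k => ?_
  simp only [Equiv.neg_apply, hsymm, map_mul, Complex.conj_ofReal, ← Complex.exp_conj, map_neg,
    Complex.conj_I, map_intCast]
  push_cast
  ring_nf

theorem integral_exp_int_mul (k : ℤ) :
    ∫ x in (0 : ℝ)..(2 * Real.pi), Complex.exp (Complex.I * (k : ℂ) * (x : ℂ))
      = if k = 0 then ((2 * Real.pi : ℝ) : ℂ) else 0 := by
  split_ifs with h
  · simp [h]
  · have hk : Complex.I * (k : ℂ) ≠ 0 := mul_ne_zero Complex.I_ne_zero (by exact_mod_cast h)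
    rw [integral_exp_mul_complex hk]
    have : Complex.I * (k : ℂ) * ((2 * Real.pi : ℝ) : ℂ) = k * (2 * Real.pi * Complex.I) := by
      push_cast; ring
    rw [this, Complex.exp_int_mul_two_pi_mul_I]
    simp

/-- Fourier inversion: absolute summability allows termwise integration, and orthogonality of the
exponentials keeps only the term `k = j`. -/
theorem integral_exp_mul_spectralDensity (hr : Summable fun k => |r k|)
    (hsymm : ∀ k, r (-k) = r k) (j : ℤ) :
    ∫ x in (0 : ℝ)..(2 * Real.pi), Complex.exp (Complex.I * (j : ℂ) * (x : ℂ))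
        * (spectralDensity r x : ℂ)
      = (2 * Real.pi * r j : ℝ) := by
  have hs := intervalIntegral.hasSum_integral_of_dominated_convergence (μ := volume)
    (a := 0) (b := 2 * Real.pi)
    (F := fun (k : ℤ) (x : ℝ) => (r k : ℂ) * Complex.exp (Complex.I * ((j - k : ℤ) : ℂ) * (x : ℂ)))
    (f := fun x : ℝ => Complex.exp (Complex.I * (j : ℂ) * (x : ℂ)) * (spectralDensity r x : ℂ))
    (fun k _ => |r k|) (fun k => by
      apply Continuous.aestronglyMeasurable; fun_prop)
    (fun k => Eventually.of_forall fun x _ => by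
      have : Complex.I * ((j - k : ℤ) : ℂ) * (x : ℂ)
          = (((j - k : ℤ) * x : ℝ) : ℂ) * Complex.I := by push_cast; ring
      rw [norm_mul, this, Complex.norm_exp_ofReal_mul_I, mul_one, Complex.norm_real,
        Real.norm_eq_abs])
    (Eventually.of_forall fun x _ => hr) (by simp)
    (Eventually.of_forall fun x _ => by
      have := ((summable_spectral_term hr x).hasSum).mul_left
        (Complex.exp (Complex.I * (j : ℂ) * (x : ℂ)))
      rw [← ofReal_spectralDensity hsymm] at this
      refine (congrArg (HasSum · _) (funext fun k => ?_)).mpr this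
      rw [mul_left_comm, ← Complex.exp_add]
      congr 2
      push_cast
      ring)
  rw [← hs.tsum_eq]
  simp only [intervalIntegral.integral_const_mul, integral_exp_int_mul]
  rw [tsum_eq_single j fun k hk => by simp [sub_ne_zero.2 hk.symm]]
  simp
  ring

/-- The quadratic form of a Toeplitz matrix as an integral against its symbol. -/
theorem integral_normSq_mul_spectralDensity (hr : Summable fun k => |r k|)
    (hsymm : ∀ k, r (-k) = r k) {n : ℕ} (z : Fin n → ℝ) :
    ∫ x in (0 : ℝ)..(2 * Real.pi),
        ‖∑ i : Fin n, (z i : ℂ) * circleMap 0 1 x ^ (i : ℕ)‖ ^ 2 * spectralDensity r x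
      = 2 * Real.pi * ∑ i, ∑ j, z i * z j * r ((i : ℕ) - (j : ℕ)) := by
  have h (x : ℝ) : ((‖∑ i : Fin n, (z i : ℂ) * circleMap 0 1 x ^ (i : ℕ)‖ ^ 2
        * spectralDensity r x : ℝ) : ℂ)
      = ∑ i : Fin n, ∑ j : Fin n, (z i * z j : ℂ) *
        (Complex.exp (Complex.I * (((i : ℕ) - (j : ℕ) : ℤ) : ℂ) * (x : ℂ))
          * (spectralDensity r x : ℂ)) := by
    push_cast
    rw [← Complex.mul_conj', map_sum, Finset.sum_mul_sum, Finset.sum_mul]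
    refine Finset.sum_congr rfl fun i _ => ?_
    rw [Finset.sum_mul]
    refine Finset.sum_congr rfl fun j _ => ?_
    simp only [circleMap_zero, map_mul, Complex.conj_ofReal, ← Complex.exp_conj,
      Complex.conj_I, Complex.ofReal_one, one_mul, ← Complex.exp_nat_mul, map_natCast]
    rw [mul_mul_mul_comm, ← Complex.exp_add, mul_assoc]
    congr 3
    ring
  rw [← Complex.ofReal_inj, ← intervalIntegral.integral_ofReal]
  simp only [h]
  have hc : Continuous fun x => (spectralDensity r x : ℂ) :=
    Complex.continuous_ofReal.comp (continuous_spectralDensity hr)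
  rw [intervalIntegral.integral_finsetSum fun i _ => Continuous.intervalIntegrable (by fun_prop) _ _]
  push_cast
  rw [Finset.mul_sum]
  refine Finset.sum_congr rfl fun i _ => ?_
  rw [intervalIntegral.integral_finsetSum fun i _ => Continuous.intervalIntegrable (by fun_prop) _ _,
    Finset.mul_sum]
  refine Finset.sum_congr rfl fun j _ => ?_
  rw [intervalIntegral.integral_const_mul]
  have := integral_exp_mul_spectralDensity hr hsymm ((i : ℕ) - (j : ℕ))
  push_cast at this
  rw [this]
  ring

end Spectral

/-! ### The Szegő lower bound for Toeplitz forms. -/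

/-- One step of the Szegő inequality: among monic polynomials the weighted mean square over the
circle is at least the geometric mean of the weight. -/
theorem exp_average_log_le_average_norm_sq_mul {p : Polynomial ℂ} (hp : 1 ≤ ‖p.leadingCoeff‖)
    {f : ℝ → ℝ} (hf : Continuous f) (hpos : ∀ x, 0 < f x) :
    Real.exp ((2 * Real.pi)⁻¹ * ∫ x in (0 : ℝ)..(2 * Real.pi), Real.log (f x))
      ≤ (2 * Real.pi)⁻¹ * ∫ x in (0 : ℝ)..(2 * Real.pi),
          ‖p.eval (circleMap 0 1 x)‖ ^ 2 * f x := by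
  have hpi : 0 < 2 * Real.pi := Real.two_pi_pos
  have hp0 : p ≠ 0 := by rintro rfl; simp at hp; linarith
  -- The Mahler measure being at least `1` says that `log ‖p‖` has nonnegative mean over the circle.
  have hm := Polynomial.one_le_mahlerMeasure_of_one_le_norm_leadingCoeff hp
  rw [Polynomial.mahlerMeasure_def_of_ne_zero hp0, Real.one_le_exp_iff] at hm
  have hlogf : Continuous fun x => Real.log (f x) := hf.log fun x => (hpos x).ne'
  have hIp := p.intervalIntegrable_mahlerMeasure
  set G := (2 * Real.pi)⁻¹ * ∫ x in (0 : ℝ)..(2 * Real.pi), Real.log (f x) with hG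
  have hgc : Continuous fun x => ‖p.eval (circleMap 0 1 x)‖ ^ 2 * f x := by fun_prop
  have hae : ∀ᵐ x : ℝ, p.eval (circleMap 0 1 x) ≠ 0 := by
    have hfin : ({z : ℂ | p.IsRoot z} : Set ℂ).Countable :=
      (Polynomial.finite_setOfPred_isRoot hp0).countable
    have hc : (circleMap 0 1 ⁻¹' {z : ℂ | p.IsRoot z}).Countable :=
      hfin.preimage_circleMap 0 one_ne_zero
    filter_upwards [hc.ae_notMem volume] with x hx using hx
  -- Jensen's inequality by a tangent line: `y + 1 ≤ exp y` at `y = log (‖p‖² f) - G`. It is needed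
  -- only off the zeros of `p`, a null set, where `Real.log 0 = 0` would spoil it.
  have hle : ∫ x in (0 : ℝ)..(2 * Real.pi),
        (2 * Real.log ‖p.eval (circleMap 0 1 x)‖ + Real.log (f x) + (1 - G))
      ≤ ∫ x in (0 : ℝ)..(2 * Real.pi),
        Real.exp (-G) * (‖p.eval (circleMap 0 1 x)‖ ^ 2 * f x) := by
    refine intervalIntegral.integral_mono_ae hpi.le
      (((hIp.const_mul 2).add (hlogf.intervalIntegrable _ _)).add (by simp))
      ((hgc.const_mul _).intervalIntegrable _ _) ?_
    filter_upwards [hae] with x hx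
    have hx' : 0 < ‖p.eval (circleMap 0 1 x)‖ := norm_pos_iff.2 hx
    have h1 := Real.add_one_le_exp
      (2 * Real.log ‖p.eval (circleMap 0 1 x)‖ + Real.log (f x) - G)
    have h2 : Real.exp (2 * Real.log ‖p.eval (circleMap 0 1 x)‖ + Real.log (f x) - G)
        = Real.exp (-G) * (‖p.eval (circleMap 0 1 x)‖ ^ 2 * f x) := by
      rw [sub_eq_add_neg, Real.exp_add, Real.exp_add, Real.exp_log (hpos x), mul_comm 2,
        Real.exp_mul, Real.exp_log hx', mul_comm]
      norm_num
    linarith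
  rw [intervalIntegral.integral_add ((hIp.const_mul 2).add (hlogf.intervalIntegrable _ _))
    (by simp), intervalIntegral.integral_add (hIp.const_mul 2) (hlogf.intervalIntegrable _ _),
    intervalIntegral.integral_const_mul, intervalIntegral.integral_const_mul,
    intervalIntegral.integral_const, smul_eq_mul, sub_zero] at hle
  have hJ : ∫ x in (0 : ℝ)..(2 * Real.pi), Real.log (f x) = 2 * Real.pi * G := by
    rw [hG]; field_simp
  have hI : 0 ≤ ∫ x in (0 : ℝ)..(2 * Real.pi), Real.log ‖p.eval (circleMap 0 1 x)‖ := by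
    have := mul_nonneg hpi.le hm
    rwa [mul_inv_cancel_left₀ hpi.ne'] at this
  rw [hJ] at hle
  have h3 : 2 * Real.pi ≤ Real.exp (-G) * ∫ x in (0 : ℝ)..(2 * Real.pi),
      ‖p.eval (circleMap 0 1 x)‖ ^ 2 * f x := by linarith
  rw [Real.exp_neg, ← div_eq_inv_mul, le_div_iff₀ (Real.exp_pos _)] at h3
  rw [← div_eq_inv_mul, le_div_iff₀ hpi]
  linarith

/-- The `n × n` Toeplitz matrix with entries `ρ (i - j)`. -/
def toeplitz (ρ : ℤ → ℝ) (n : ℕ) : Matrix (Fin n) (Fin n) ℝ :=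
  Matrix.of fun i j => ρ ((i : ℕ) - (j : ℕ))

/-- The geometric mean of the spectral density over a period. -/
noncomputable def spectralGeomMean (ρ : ℤ → ℝ) : ℝ :=
  Real.exp ((2 * Real.pi)⁻¹ * ∫ x in (0 : ℝ)..(2 * Real.pi), Real.log (spectralDensity ρ x))

theorem spectralGeomMean_pos (ρ : ℤ → ℝ) : 0 < spectralGeomMean ρ := Real.exp_pos _

open Matrix in
theorem dotProduct_toeplitz_mulVec (ρ : ℤ → ℝ) {n : ℕ} (z : Fin n → ℝ) :
    z ⬝ᵥ (toeplitz ρ n *ᵥ z) = ∑ i, ∑ j, z i * z j * ρ ((i : ℕ) - (j : ℕ)) := by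
  simp only [dotProduct, mulVec, Finset.mul_sum, toeplitz, of_apply]
  exact Finset.sum_congr rfl fun i _ => Finset.sum_congr rfl fun j _ => by ring

section Szego

variable {ρ : ℤ → ℝ}

-- Such a `z` is the coefficient vector of a monic polynomial of degree `i`, and the Toeplitz form
-- is its mean square on the circle weighted by the spectral density.
open Matrix in
theorem spectralGeomMean_le_dotProduct_toeplitz (hr : Summable fun k => |ρ k|)
    (hsymm : ∀ k, ρ (-k) = ρ k) (hpos : ∀ x, 0 < spectralDensity ρ x) {n : ℕ} {z : Fin n → ℝ}
    {i : Fin n} (hi : z i = 1) (hlt : ∀ j, i < j → z j = 0) :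
    spectralGeomMean ρ ≤ z ⬝ᵥ (toeplitz ρ n *ᵥ z) := by
  set p : Polynomial ℂ := ∑ j : Fin n, Polynomial.monomial (j : ℕ) (z j : ℂ) with hp
  have hcoeff (k : ℕ) : p.coeff k = ∑ j : Fin n, if (j : ℕ) = k then (z j : ℂ) else 0 := by
    simp [hp, Polynomial.coeff_monomial]
  have hci : p.coeff i = 1 := by
    rw [hcoeff, Finset.sum_eq_single i (fun j _ hj => if_neg fun h => hj (Fin.ext h)) (by simp)]
    simp [hi]
  have hdeg : p.natDegree = i := by
    refine Polynomial.natDegree_eq_of_le_of_coeff_ne_zero ?_ (by rw [hci]; exact one_ne_zero)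
    refine Polynomial.natDegree_le_iff_coeff_eq_zero.2 fun k hk => ?_
    rw [hcoeff]
    refine Finset.sum_eq_zero fun j _ => ?_
    split_ifs with h
    · rw [hlt j (by rw [Fin.lt_def]; omega)]; simp
    · rfl
  have hlc : 1 ≤ ‖p.leadingCoeff‖ := by
    rw [Polynomial.leadingCoeff, hdeg, hci, norm_one]
  have h := exp_average_log_le_average_norm_sq_mul hlc (continuous_spectralDensity hr) hpos
  have heval (x : ℝ) : p.eval (circleMap 0 1 x)
      = ∑ j : Fin n, (z j : ℂ) * circleMap 0 1 x ^ (j : ℕ) := by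
    simp [hp, Polynomial.eval_finsetSum]
  simp only [heval] at h
  rwa [integral_normSq_mul_spectralDensity hr hsymm, inv_mul_cancel_left₀ Real.two_pi_pos.ne',
    ← dotProduct_toeplitz_mulVec] at h

-- Dividing a nonzero vector by its last nonzero entry makes it monic, so the Szegő bound applies.
open Matrix in
theorem posDef_toeplitz (hr : Summable fun k => |ρ k|)
    (hsymm : ∀ k, ρ (-k) = ρ k) (hpos : ∀ x, 0 < spectralDensity ρ x) (n : ℕ) :
    (toeplitz ρ n).PosDef := by
  refine Matrix.PosDef.of_dotProduct_mulVec_pos ?_ fun z hz => ?_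
  · ext i j
    simp only [toeplitz, conjTranspose_apply, of_apply, star_trivial]
    rw [← hsymm, neg_sub]
  · rw [star_trivial]
    have hne : (Finset.univ.filter fun i => z i ≠ 0).Nonempty := by
      obtain ⟨i, hi⟩ := Function.ne_iff.1 hz
      exact ⟨i, by simpa using hi⟩
    set i := (Finset.univ.filter fun i => z i ≠ 0).max' hne with hi
    have hzi : z i ≠ 0 := by simpa using Finset.max'_mem _ hne
    have hlt : ∀ j, i < j → z j = 0 := fun j hj => by
      by_contra h
      exact absurd (Finset.le_max' _ j (by simpa using h)) (not_le.2 hj)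
    have h := spectralGeomMean_le_dotProduct_toeplitz hr hsymm hpos (z := (z i)⁻¹ • z) (i := i)
      (by simp [hzi]) fun j hj => by simp [hlt j hj]
    have h' := (spectralGeomMean_pos ρ).trans_le h
    rw [mulVec_smul, smul_dotProduct, dotProduct_smul, smul_smul, smul_eq_mul] at h'
    exact pos_of_mul_pos_right h' (mul_self_nonneg _)

end Szego

/-! ### LDL decomposition and Gaussian integrals. -/

-- Row `i` is the Gram–Schmidt vector of `e_i`: it differs from `e_i` by a combination of earlier
-- rows, which vanish in coordinate `i`.
open Matrix in
theorem LDL.lowerInv_apply_self {n : Type*} [LinearOrder n] [WellFoundedLT n]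
    [LocallyFiniteOrderBot n] [Fintype n] {S : Matrix n n ℝ} (hS : S.PosDef) (i : n) :
    LDL.lowerInv hS i i = 1 := by
  let := (Sᵀ.toNormedAddCommGroup hS.transpose)
  let := (Sᵀ.toInnerProductSpace hS.transpose.posSemidef)
  have h := congrFun (InnerProductSpace.gramSchmidt_def'' ℝ (Pi.basisFun ℝ n) i) i
  rw [Pi.add_apply, Finset.sum_apply, Finset.sum_eq_zero] at h
  · have h1 : (Pi.basisFun ℝ n i) i = LDL.lowerInv hS i i + 0 := h
    simpa using h1.symm
  · intro j hj
    have : LDL.lowerInv hS j i = 0 := LDL.lowerInv_triangular hS (Finset.mem_Iio.1 hj)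
    exact mul_eq_zero_of_right _ this

open Matrix in
theorem LDL.det_lowerInv {n : Type*} [LinearOrder n] [WellFoundedLT n]
    [LocallyFiniteOrderBot n] [Fintype n] {S : Matrix n n ℝ} (hS : S.PosDef) :
    (LDL.lowerInv hS).det = 1 := by
  rw [Matrix.det_of_isLowerTriangular (LDL.lowerInv hS) fun i j hij => LDL.lowerInv_triangular hS hij]
  exact Finset.prod_eq_one fun i _ => LDL.lowerInv_apply_self hS i

theorem lintegral_exp_neg_mul_sq {b : ℝ} (hb : 0 < b) :
    ∫⁻ x : ℝ, ENNReal.ofReal (Real.exp (-b * x ^ 2)) = ENNReal.ofReal (√(Real.pi / b)) := by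
  rw [← integral_gaussian, ofReal_integral_eq_lintegral_ofReal (integrable_exp_neg_mul_sq hb)
    (Eventually.of_forall fun x => (Real.exp_pos _).le)]

open Matrix in
/-- A Gaussian integral is bounded by the smallest conditional variance in the LDL
decomposition. -/
theorem lintegral_exp_neg_quadratic_le {n : ℕ} {S : Matrix (Fin n) (Fin n) ℝ} (hS : S.PosDef)
    {G : ℝ} (hG : 0 < G)
    (hSG : ∀ (z : Fin n → ℝ) (i : Fin n), z i = 1 → (∀ j, i < j → z j = 0) → G ≤ z ⬝ᵥ (S *ᵥ z)) :
    ∫⁻ z : Fin n → ℝ, ENNReal.ofReal (Real.exp (-(1 / 2) * (z ⬝ᵥ (S *ᵥ z))))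
      ≤ ENNReal.ofReal (√(2 * Real.pi / G)) ^ n := by
  set L := LDL.lowerInv hS with hL
  have hdet : Lᵀ.det = 1 := by rw [det_transpose, LDL.det_lowerInv hS]
  -- The substitution `z = Lᵀ y` preserves volume and diagonalises the form, so the integral
  -- factorises.
  have hmap := Real.map_matrix_volume_pi_eq_smul_volume_pi (M := Lᵀ) (by rw [hdet]; exact one_ne_zero)
  rw [hdet, inv_one, abs_one, ENNReal.ofReal_one, one_smul] at hmap
  -- A pivot is the form evaluated at row `i` of `L`, which has entry `1` at `i` and `0` after it.
  have hD : ∀ i, G ≤ (L * S * Lᵀ) i i := fun i => by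
    have h := hSG (L i) i (LDL.lowerInv_apply_self hS i) fun j hj => LDL.lowerInv_triangular hS hj
    refine h.trans_eq ?_
    rw [Matrix.mul_assoc, mul_apply]
    rfl
  have hdiag : L * S * Lᵀ = Matrix.diagonal fun i => (L * S * Lᵀ) i i := by
    have h := LDL.diag_eq_lowerInv_conj hS
    rw [conjTranspose_eq_transpose_of_trivial, ← hL, LDL.diag] at h
    rw [← h]
    ext i j
    by_cases hij : i = j <;> simp [hij]
  have hm : Measurable fun z : Fin n → ℝ =>
      ENNReal.ofReal (Real.exp (-(1 / 2) * (z ⬝ᵥ (S *ᵥ z)))) := by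
    simp only [dotProduct, mulVec]
    fun_prop
  have hq (y : Fin n → ℝ) : (Lᵀ *ᵥ y) ⬝ᵥ (S *ᵥ (Lᵀ *ᵥ y)) = ∑ i, (L * S * Lᵀ) i i * y i ^ 2 := by
    rw [mulVec_transpose, ← dotProduct_mulVec, ← mulVec_transpose, mulVec_mulVec, mulVec_mulVec,
      congrArg (· *ᵥ y) hdiag]
    simp only [dotProduct, mulVec_diagonal]
    exact Finset.sum_congr rfl fun i _ => by ring
  have hprod (y : Fin n → ℝ) :
      ENNReal.ofReal (Real.exp (-(1 / 2) * ((Lᵀ *ᵥ y) ⬝ᵥ (S *ᵥ (Lᵀ *ᵥ y)))))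
        = ∏ i, ENNReal.ofReal (Real.exp (-((L * S * Lᵀ) i i / 2) * y i ^ 2)) := by
    rw [← ENNReal.ofReal_prod_of_nonneg fun i _ => (Real.exp_pos _).le, ← Real.exp_sum, hq,
      Finset.mul_sum]
    congr 2
    exact Finset.sum_congr rfl fun i _ => by ring
  rw [← hmap, lintegral_map hm (LinearMap.continuous_of_finiteDimensional _).measurable]
  simp only [toLin'_apply, hprod]
  rw [volume_pi, lintegral_fin_pi_prod_eq_prod _
    (f := fun i x => ENNReal.ofReal (Real.exp (-((L * S * Lᵀ) i i / 2) * x ^ 2)))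
    fun i => by fun_prop]
  refine (Finset.prod_le_prod' fun i _ => ?_).trans_eq (by rw [Finset.prod_const, Finset.card_univ,
    Fintype.card_fin])
  have hDi : 0 < (L * S * Lᵀ) i i := hG.trans_le (hD i)
  rw [lintegral_exp_neg_mul_sq (by positivity), div_div_eq_mul_div, mul_comm Real.pi]
  gcongr
  exact hD i

/-! ### The exponential moment of the fading energy. -/

section ExponentialMoment

variable {Ω : Type*} [MeasurableSpace Ω] {P : Measure Ω}

theorem ProbabilityTheory.HasGaussianLaw.lintegral_exp_mul {X : Ω → ℝ} (hX : HasGaussianLaw X P)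
    (h0 : ∫ ω, X ω ∂P = 0) (t : ℝ) :
    ∫⁻ ω, ENNReal.ofReal (Real.exp (t * X ω)) ∂P
      = ENNReal.ofReal (Real.exp (Var[X; P] * t ^ 2 / 2)) := by
  have hmap := hX.map_eq_gaussianReal
  rw [h0] at hmap
  have h := mgf_gaussianReal hmap t
  rw [zero_mul, zero_add, Real.coe_toNNReal _ (variance_nonneg _ _)] at h
  rw [← h, mgf, ofReal_integral_eq_lintegral_ofReal _ (Eventually.of_forall fun x =>
    (Real.exp_pos _).le)]
  have hi : Integrable (fun x : ℝ => Real.exp (t * x)) (P.map X) := by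
    rw [hmap]; exact integrable_exp_mul_gaussianReal t
  exact hi.comp_aemeasurable hX.aemeasurable

theorem lintegral_gaussianReal_exp_mul (t : ℝ) :
    ∫⁻ x, ENNReal.ofReal (Real.exp (t * x)) ∂(gaussianReal 0 1)
      = ENNReal.ofReal (Real.exp (t ^ 2 / 2)) := by
  have h := HasGaussianLaw.lintegral_exp_mul (X := id) (P := gaussianReal 0 1)
    IsGaussian.hasGaussianLaw_id (by simp) t
  simpa using h

end ExponentialMoment

/-- The coefficient sequence of the symbol `1 - a Σ`. -/
def oneSubCoeff (a : ℝ) (r : ℤ → ℝ) (k : ℤ) : ℝ :=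
  (if k = 0 then 1 else 0) - a * r k

section OneSub

variable {r : ℤ → ℝ}

theorem summable_abs_oneSubCoeff (a : ℝ) (hr : Summable fun k => |r k|) :
    Summable fun k => |oneSubCoeff a r k| := by
  rw [summable_abs_iff] at hr ⊢
  exact (summable_of_ne_finset_zero (s := {0}) fun k hk => if_neg (by simpa using hk)).sub
    (hr.mul_left a)

theorem spectralDensity_oneSubCoeff (a : ℝ) (hr : Summable fun k => |r k|) (x : ℝ) :
    spectralDensity (oneSubCoeff a r) x = 1 - a * spectralDensity r x := by
  have h1 : HasSum (fun k : ℤ => ((if k = 0 then 1 else 0 : ℝ) : ℂ)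
      * Complex.exp (-(Complex.I * (k : ℂ) * (x : ℂ)))) 1 := by
    convert hasSum_single (0 : ℤ) ?_ using 1
    · simp
    · intro k hk
      simp [hk]
  have h2 := h1.sub ((summable_spectral_term hr x).hasSum.mul_left (a : ℂ))
  have h3 : (fun k : ℤ => ((oneSubCoeff a r k : ℝ) : ℂ)
      * Complex.exp (-(Complex.I * (k : ℂ) * (x : ℂ)))) = fun k : ℤ =>
        ((if k = 0 then 1 else 0 : ℝ) : ℂ) * Complex.exp (-(Complex.I * (k : ℂ) * (x : ℂ)))
        - (a : ℂ) * ((r k : ℂ) * Complex.exp (-(Complex.I * (k : ℂ) * (x : ℂ)))) := by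
    ext k
    simp only [oneSubCoeff]
    push_cast
    ring
  rw [spectralDensity, h3, h2.tsum_eq]
  simp [spectralDensity]

theorem sum_mul_mul_oneSubCoeff (a : ℝ) {n : ℕ} (z : Fin n → ℝ) :
    ∑ i, ∑ j, z i * z j * oneSubCoeff a r ((i : ℕ) - (j : ℕ))
      = ∑ i, z i ^ 2 - a * ∑ i, ∑ j, z i * z j * r ((i : ℕ) - (j : ℕ)) := by
  rw [Finset.mul_sum, ← Finset.sum_sub_distrib]
  refine Finset.sum_congr rfl fun i _ => ?_
  simp only [oneSubCoeff, mul_sub, Finset.sum_sub_distrib, Finset.mul_sum]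
  congr 1
  · rw [Finset.sum_eq_single i]
    · simp [sq]
    · intro j _ hj
      have : ((i : ℕ) : ℤ) - (j : ℕ) ≠ 0 := by
        rw [sub_ne_zero]
        exact fun h => hj (Fin.ext (by exact_mod_cast h.symm))
      simp [this]
    · simp
  · exact Finset.sum_congr rfl fun j _ => by ring

end OneSub

namespace IsStationaryGaussian

variable {Ω : Type*} [MeasurableSpace Ω] {P : Measure Ω} {θ : ℤ → Ω → ℝ}

theorem integral_mul (hθ : IsStationaryGaussian P θ) (s t : ℤ) :
    ∫ ω, θ s ω * θ t ω ∂P = autocov P θ (t - s) := by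
  have hm : Measurable fun ω => fun t : ℤ => θ t ω := measurable_pi_lambda _ hθ.measurable
  have hms : Measurable fun ω => fun t : ℤ => θ (t + s) ω :=
    measurable_pi_lambda _ fun t => hθ.measurable _
  have hF : Measurable fun x : ℤ → ℝ => x 0 * x (t - s) := by fun_prop
  have h := congrArg (fun μ => ∫ x, x 0 * x (t - s) ∂μ) (hθ.stationary s)
  rw [integral_map hms.aemeasurable hF.aestronglyMeasurable,
    integral_map hm.aemeasurable hF.aestronglyMeasurable] at h
  simpa [autocov] using h

theorem autocov_neg (hθ : IsStationaryGaussian P θ) (k : ℤ) :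
    autocov P θ (-k) = autocov P θ k := by
  have h := hθ.integral_mul k 0
  rw [zero_sub] at h
  rw [← h, autocov]
  simp only [mul_comm]

theorem hasGaussianLaw_sum_mul (hθ : IsStationaryGaussian P θ) {n : ℕ} (z : Fin n → ℝ) :
    HasGaussianLaw (fun ω => ∑ i : Fin n, z i * θ ((i : ℕ) + 1 : ℤ) ω) P := by
  have h1 : IsGaussianProcess (fun (i : Fin n) => θ ((i : ℕ) + 1 : ℤ)) P :=
    hθ.gaussian.comp_right fun i : Fin n => ((i : ℕ) + 1 : ℤ)
  exact (h1.smul z).hasGaussianLaw_fun_sum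

theorem memLp_two (hθ : IsStationaryGaussian P θ) (t : ℤ) : MemLp (θ t) 2 P :=
  (hθ.gaussian.hasGaussianLaw_eval t).memLp_two

theorem integral_sum_mul (hθ : IsStationaryGaussian P θ) {n : ℕ} (z : Fin n → ℝ) :
    ∫ ω, ∑ i : Fin n, z i * θ ((i : ℕ) + 1 : ℤ) ω ∂P = 0 := by
  have := hθ.gaussian.isProbabilityMeasure
  rw [integral_finsetSum _ fun i _ => ((hθ.memLp_two _).integrable (by norm_num)).const_mul _]
  simp [integral_const_mul, hθ.zero_mean]

theorem variance_sum_mul (hθ : IsStationaryGaussian P θ) {n : ℕ} (z : Fin n → ℝ) :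
    Var[fun ω => ∑ i : Fin n, z i * θ ((i : ℕ) + 1 : ℤ) ω; P]
      = ∑ i : Fin n, ∑ j : Fin n, z i * z j * autocov P θ ((i : ℕ) - (j : ℕ)) := by
  have := hθ.gaussian.isProbabilityMeasure
  rw [variance_of_integral_eq_zero (hθ.hasGaussianLaw_sum_mul z).aemeasurable
    (hθ.integral_sum_mul z)]
  have hint (i j : Fin n) : Integrable (fun ω => (z i * θ ((i : ℕ) + 1 : ℤ) ω)
      * (z j * θ ((j : ℕ) + 1 : ℤ) ω)) P :=
    ((hθ.memLp_two _).const_mul (z i)).integrable_mul ((hθ.memLp_two _).const_mul (z j))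
  simp only [sq, Finset.sum_mul_sum]
  rw [integral_finsetSum _ fun i _ => integrable_finsetSum _ fun j _ => hint i j]
  refine Finset.sum_congr rfl fun i _ => ?_
  rw [integral_finsetSum _ fun j _ => hint i j]
  refine Finset.sum_congr rfl fun j _ => ?_
  simp only [mul_mul_mul_comm (z i)]
  -- `integral_mul` yields the lag `j - i`; evenness of the covariance turns it into `i - j`.
  rw [integral_const_mul, hθ.integral_mul, ← hθ.autocov_neg]
  congr 2
  ring

/-- The auxiliary Gaussian vector makes only the law of linear forms in `θ` necessary, so neither a
joint density nor an invertible covariance matrix of `θ` is needed. -/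
theorem lintegral_exp_mul_sum_sq_le (hθ : IsStationaryGaussian P θ)
    (hr : Summable fun k => |autocov P θ k|) {c : ℝ} (hc : 0 ≤ c)
    (hpos : ∀ x, 0 < 1 - 2 * c * spectralDensity (autocov P θ) x) (n : ℕ) :
    ∫⁻ ω, ENNReal.ofReal (Real.exp (c * ∑ i : Fin n, θ ((i : ℕ) + 1 : ℤ) ω ^ 2)) ∂P
      ≤ ENNReal.ofReal (Real.exp (-(n * (4 * Real.pi)⁻¹ * ∫ x in (0 : ℝ)..(2 * Real.pi),
          Real.log (1 - 2 * c * spectralDensity (autocov P θ) x)))) := by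
  have := hθ.gaussian.isProbabilityMeasure
  set r := autocov P θ with hrdef
  set ρ := oneSubCoeff (2 * c) r with hρ
  have hsd (x : ℝ) : spectralDensity ρ x = 1 - 2 * c * spectralDensity r x :=
    spectralDensity_oneSubCoeff _ hr x
  have hρs : Summable fun k => |ρ k| := summable_abs_oneSubCoeff _ hr
  have hρsymm (k : ℤ) : ρ (-k) = ρ k := by
    simp [hρ, oneSubCoeff, hrdef, hθ.autocov_neg]
  have hρpos (x : ℝ) : 0 < spectralDensity ρ x := by rw [hsd]; exact hpos x
  have hsq : √(2 * c) ^ 2 = 2 * c := Real.sq_sqrt (by linarith)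
  have hmeas := hθ.measurable
  -- Each factor is linearised by `exp(c x²) = E exp(√(2c) x Z)` with `Z` standard normal.
  have h1 (ω : Ω) : ENNReal.ofReal (Real.exp (c * ∑ i : Fin n, θ ((i : ℕ) + 1 : ℤ) ω ^ 2))
      = ∫⁻ z : Fin n → ℝ, ENNReal.ofReal (Real.exp (√(2 * c) *
          ∑ i, z i * θ ((i : ℕ) + 1 : ℤ) ω)) ∂(Measure.pi fun _ => gaussianReal 0 1) := by
    have hprod (z : Fin n → ℝ) : ENNReal.ofReal (Real.exp (√(2 * c) *
          ∑ i, z i * θ ((i : ℕ) + 1 : ℤ) ω))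
        = ∏ i : Fin n, ENNReal.ofReal (Real.exp (√(2 * c) * θ ((i : ℕ) + 1 : ℤ) ω * z i)) := by
      rw [← ENNReal.ofReal_prod_of_nonneg fun i _ => (Real.exp_pos _).le, ← Real.exp_sum,
        Finset.mul_sum]
      congr 2
      exact Finset.sum_congr rfl fun i _ => by ring
    simp only [hprod]
    rw [lintegral_fin_pi_prod_eq_prod _ (f := fun i x =>
      ENNReal.ofReal (Real.exp (√(2 * c) * θ ((i : ℕ) + 1 : ℤ) ω * x))) fun i => by fun_prop]
    simp only [lintegral_gaussianReal_exp_mul]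
    rw [← ENNReal.ofReal_prod_of_nonneg fun i _ => (Real.exp_pos _).le, ← Real.exp_sum,
      Finset.mul_sum]
    congr 2
    refine Finset.sum_congr rfl fun i _ => ?_
    rw [mul_pow, hsq]
    ring
  simp only [h1]
  rw [lintegral_lintegral_swap (Measurable.aemeasurable (by fun_prop))]
  simp only [(hθ.hasGaussianLaw_sum_mul _).lintegral_exp_mul (hθ.integral_sum_mul _),
    hθ.variance_sum_mul, hsq, ← hrdef]
  rw [lintegral_pi_gaussianReal one_ne_zero (by fun_prop)]
  -- The exponents combine to `-(1/2) zᵀ (I - 2cR) z`, where `R` is the covariance matrix of the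
  -- fading.
  have h2 (z : Fin n → ℝ) : (∏ i, gaussianPDF 0 1 (z i)) * ENNReal.ofReal (Real.exp
        ((∑ i : Fin n, ∑ j : Fin n, z i * z j * r ((i : ℕ) - (j : ℕ))) * (2 * c) / 2))
      = ENNReal.ofReal ((√(2 * Real.pi))⁻¹ ^ n) *
        ENNReal.ofReal (Real.exp (-(1 / 2) * (z ⬝ᵥ (Matrix.mulVec (toeplitz ρ n) z)))) := by
    simp only [gaussianPDF]
    rw [← ENNReal.ofReal_prod_of_nonneg fun i _ => gaussianPDFReal_nonneg _ _ _,
      ← ENNReal.ofReal_mul (Finset.prod_nonneg fun i _ => gaussianPDFReal_nonneg _ _ _),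
      ← ENNReal.ofReal_mul (by positivity)]
    congr 1
    simp only [gaussianPDFReal, Finset.prod_mul_distrib, ← Real.exp_sum, Finset.prod_const,
      Finset.card_univ, Fintype.card_fin, NNReal.coe_one, mul_one, sub_zero]
    rw [mul_assoc, ← Real.exp_add, dotProduct_toeplitz_mulVec, sum_mul_mul_oneSubCoeff,
      ← Finset.sum_div, Finset.sum_neg_distrib]
    congr 2
    ring
  simp only [h2]
  rw [lintegral_const_mul' _ _ ENNReal.ofReal_ne_top]
  have h3 := lintegral_exp_neg_quadratic_le (posDef_toeplitz hρs hρsymm hρpos n)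
    (spectralGeomMean_pos ρ) fun z i hi hlt =>
      spectralGeomMean_le_dotProduct_toeplitz hρs hρsymm hρpos hi hlt
  refine (mul_le_mul_right h3 _).trans_eq ?_
  rw [← ENNReal.ofReal_pow (by positivity), ← ENNReal.ofReal_mul (by positivity), ← mul_pow]
  congr 1
  -- With `G` the geometric mean, the factors `√(2π)` cancel and leave `G^(-n/2)`.
  rw [Real.sqrt_div (by positivity), ← mul_div_assoc,
    inv_mul_cancel₀ (by positivity), one_div, spectralGeomMean, ← Real.exp_half, ← Real.exp_neg,
    ← Real.exp_nat_mul]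
  simp only [hsd]
  congr 1
  rw [mul_inv, mul_inv]
  ring

end IsStationaryGaussian

/-! ### From one-shot bounds to exponents in `EReal`. -/

section Exponents

theorem EReal.monotone_coe_add (a : ℝ) : Monotone fun x : EReal => (a : EReal) + x :=
  fun _ _ h => add_le_add le_rfl h

theorem EReal.continuous_coe_add (a : ℝ) : Continuous fun x : EReal => (a : EReal) + x := by
  refine continuous_iff_continuousAt.2 fun x => ?_
  have h : ContinuousAt (fun p : EReal × EReal => p.1 + p.2) ((a : EReal), x) :=
    EReal.continuousAt_add (.inl (EReal.coe_ne_top a)) (.inl (EReal.coe_ne_bot a))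
  exact ContinuousAt.comp (f := fun x : EReal => ((a : EReal), x)) h (by fun_prop)

theorem EReal.limsup_le_coe_add_mul {u w : ℕ → EReal} {a b : ℝ} (hb : 0 ≤ b)
    (h : ∀ᶠ n in atTop, u n ≤ a + b * w n) :
    limsup u atTop ≤ a + b * limsup w atTop := by
  refine (limsup_le_limsup h).trans_eq ?_
  rw [← EReal.limsup_const_mul_of_nonneg_of_ne_top (EReal.coe_nonneg.2 hb) (EReal.coe_ne_top b)]
  exact ((EReal.monotone_coe_add a).map_limsup_of_continuousAt (fun n => (b : EReal) * w n)
    (EReal.continuous_coe_add a).continuousAt).symm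

theorem EReal.liminf_le_coe_add_mul {u w : ℕ → EReal} {a b : ℝ} (hb : 0 ≤ b)
    (h : ∀ᶠ n in atTop, u n ≤ a + b * w n) :
    liminf u atTop ≤ a + b * liminf w atTop := by
  refine (liminf_le_liminf h).trans_eq ?_
  rw [← EReal.liminf_const_mul_of_nonneg_of_ne_top (EReal.coe_nonneg.2 hb) (EReal.coe_ne_top b)]
  exact ((EReal.monotone_coe_add a).map_liminf_of_continuousAt (fun n => (b : EReal) * w n)
    (EReal.continuous_coe_add a).continuousAt).symm

theorem EReal.mul_neg_add_le_neg {x y : EReal} {a b : ℝ} (h : x ≤ a + b * y) :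
    (b : EReal) * -y + ((-a : ℝ) : EReal) ≤ -x := by
  rw [mul_neg, EReal.coe_neg, ← sub_eq_add_neg,
    ← EReal.neg_add (.inr (EReal.coe_ne_top a)) (.inr (EReal.coe_ne_bot a)), add_comm]
  exact EReal.neg_le_neg_iff.2 h

/-- Solving for `x` needs cases, because exponents may be infinite: `x = ⊤` forces `y = ⊤`, and a
finite `x` excludes `y = ⊥`. -/
theorem EReal.le_inv_mul_add {x y : EReal} {a b : ℝ} (hb : 0 < b)
    (h : (b : EReal) * x + a ≤ y) :
    x ≤ ((b⁻¹ : ℝ) : EReal) * y + ((-(b⁻¹ * a) : ℝ) : EReal) := by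
  induction x with
  | bot => exact bot_le
  | top =>
    rw [EReal.coe_mul_top_of_pos hb, EReal.top_add_coe, top_le_iff] at h
    rw [h, EReal.coe_mul_top_of_pos (inv_pos.2 hb), EReal.top_add_coe]
  | coe x =>
    induction y with
    | bot =>
      rw [← EReal.coe_mul, ← EReal.coe_add, le_bot_iff] at h
      exact absurd h (EReal.coe_ne_bot _)
    | top => rw [EReal.coe_mul_top_of_pos (inv_pos.2 hb), EReal.top_add_coe]; exact le_top
    | coe y =>
      norm_cast at h ⊢
      rw [← sub_eq_add_neg, ← mul_sub, ← div_eq_inv_mul, le_div_iff₀ hb]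
      linarith

/-- A one-shot bound `p_n ≤ (e^{-nκ})^{1/α} q_n^{(α-1)/α}` carries over to both exponents. -/
theorem exponents_ge_of_le {p q : ℕ → ℝ≥0∞} {κ α : ℝ} (hα : 1 < α)
    (h : ∀ n, p n ≤ ENNReal.ofReal (Real.exp (-(n * κ))) ^ (1 / α) * q n ^ ((α - 1) / α)) :
    (((α - 1) / α : ℝ) : EReal) * lowerExponent q + ((κ / α : ℝ) : EReal) ≤ lowerExponent p ∧
    (((α - 1) / α : ℝ) : EReal) * upperExponent q + ((κ / α : ℝ) : EReal) ≤ upperExponent p := by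
  have hb : 0 ≤ (α - 1) / α := div_nonneg (by linarith) (by linarith)
  have hev : ∀ᶠ n : ℕ in atTop, ((1 / (n : ℝ) : ℝ) : EReal) * ENNReal.log (p n)
      ≤ ((-(κ / α) : ℝ) : EReal) + (((α - 1) / α : ℝ) : EReal)
        * (((1 / (n : ℝ) : ℝ) : EReal) * ENNReal.log (q n)) := by
    -- At `n = 0` the factor `1 / n` is `0` by convention and does not cancel `n`.
    filter_upwards [eventually_gt_atTop 0] with n hn
    have hn' : (0 : ℝ) < n := Nat.cast_pos.2 hn
    have h1 := ENNReal.log_monotone (h n)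
    rw [ENNReal.log_mul_add, ENNReal.log_rpow, ENNReal.log_rpow,
      ENNReal.log_ofReal_of_pos (Real.exp_pos _), Real.log_exp, ← EReal.coe_mul] at h1
    refine (mul_le_mul_of_nonneg_left h1 (EReal.coe_nonneg.2 (by positivity))).trans_eq ?_
    rw [EReal.left_distrib_of_nonneg_of_ne_top (EReal.coe_nonneg.2 (by positivity))
      (EReal.coe_ne_top _), ← EReal.coe_mul, mul_left_comm (((1 / (n : ℝ) : ℝ)) : EReal)]
    congr 2
    field_simp
  have h1 := EReal.mul_neg_add_le_neg (EReal.limsup_le_coe_add_mul hb hev)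
  have h2 := EReal.mul_neg_add_le_neg (EReal.liminf_le_coe_add_mul hb hev)
  rw [neg_neg] at h1 h2
  exact ⟨h1, h2⟩

end Exponents

/-! ### Error probabilities of the two channels at a fixed blocklength. -/

section OneShot

variable {Ω : Type*} [MeasurableSpace Ω] {M n : ℕ}

/-- The codeword of the message, as a function of the codebook, the message and the fading. -/
def codeword (t : Codebook M n × Fin M × (ℤ → ℝ)) : Fin n → ℝ := t.1 t.2.1

/-- The fading part `θ_t X_t` of the channel output. -/
def fadingShift (t : Codebook M n × Fin M × (ℤ → ℝ)) : Fin n → ℝ :=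
  fun i => t.2.2 ((i : ℕ) + 1 : ℤ) * codeword t i

theorem measurable_codeword : Measurable (codeword : Codebook M n × Fin M × (ℤ → ℝ) → _) := by
  have h : Measurable fun z : Codebook M n × Fin M => z.1 z.2 :=
    measurable_from_prod_countable_left fun j => measurable_pi_apply j
  exact h.comp (measurable_fst.prodMk (measurable_fst.comp measurable_snd))

theorem measurable_fadingShift :
    Measurable (fadingShift : Codebook M n × Fin M × (ℤ → ℝ) → _) := by
  have := measurable_codeword (M := M) (n := n)
  refine measurable_pi_lambda _ fun i => Measurable.mul (by fun_prop)
    ((measurable_pi_apply i).comp this)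

/-- The decoding errors over the channel without fading, in terms of the transmitter, the fading
and the noise. -/
def plainErrorSet (dec : Codebook M n → (Fin n → ℝ) → Fin M) :
    Set ((Codebook M n × Fin M × (ℤ → ℝ)) × (Fin n → ℝ)) :=
  {z | dec z.1.1 (z.2 + codeword z.1) ≠ z.1.2.1}

theorem measurableSet_plainErrorSet {dec : Codebook M n → (Fin n → ℝ) → Fin M}
    (hdec : Measurable fun z : Codebook M n × (Fin n → ℝ) => dec z.1 z.2) :
    MeasurableSet (plainErrorSet dec) := by
  have hc := measurable_codeword (M := M) (n := n)
  have h1 : Measurable fun z : (Codebook M n × Fin M × (ℤ → ℝ)) × (Fin n → ℝ) =>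
      dec z.1.1 (z.2 + codeword z.1) :=
    hdec.comp ((measurable_fst.comp measurable_fst).prodMk
      (measurable_snd.add (hc.comp measurable_fst)))
  exact (measurableSet_eq_fun h1 (by fun_prop)).compl

variable {P Q : Measure Ω} {σ A : ℝ} {C : Ω → Codebook M n} {m : Ω → Fin M} {θ : ℤ → Ω → ℝ}
  {Y : Ω → Fin n → ℝ} {dec : Codebook M n → (Fin n → ℝ) → Fin M}

theorem IsFadingChannel.measurable_transmitter (hP : IsFadingChannel P σ A C m θ Y)
    (hθ : ∀ t, Measurable (θ t)) :
    Measurable fun ω => (C ω, m ω, fun t : ℤ => θ t ω) :=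
  hP.measurable_code.prodMk (hP.measurable_message.prodMk (measurable_pi_lambda _ hθ))

theorem IsFadingChannel.measurable_fadingNoise (hP : IsFadingChannel P σ A C m θ Y)
    (hθ : ∀ t, Measurable (θ t)) : Measurable (fadingNoise C m θ Y) := by
  refine measurable_pi_lambda _ fun i => ?_
  have hx : Measurable fun ω => input C m ω i := (measurable_pi_apply i).comp
    (measurable_codeword.comp (hP.measurable_transmitter hθ))
  have hy : Measurable fun ω => Y ω i := (measurable_pi_apply i).comp hP.measurable_output
  exact hy.sub ((measurable_const.add (hθ _)).mul hx)

/-- The two independence hypotheses combine into independence of the noise from codebook, message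
and fading jointly; the rest is reassociation of products. -/
theorem IsFadingChannel.map_transmitter_noise [IsProbabilityMeasure P]
    (hP : IsFadingChannel P σ A C m θ Y) (hθ : ∀ t, Measurable (θ t)) :
    P.map (fun ω => ((C ω, m ω, fun t : ℤ => θ t ω), fadingNoise C m θ Y ω))
      = (P.map fun ω => (C ω, m ω, fun t : ℤ => θ t ω)).prod
        (Measure.pi fun _ : Fin n => gaussianReal 0 (σ ^ 2).toNNReal) := by
  have hN := hP.measurable_fadingNoise hθ
  have hΘ : Measurable fun ω => fun t : ℤ => θ t ω := measurable_pi_lambda _ hθ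
  have hA : Measurable fun ω => (C ω, m ω) := hP.measurable_code.prodMk hP.measurable_message
  have hT := hP.measurable_transmitter hθ
  have h1 := (indepFun_iff_map_prod_eq_prod_map_map hA.aemeasurable
    (hΘ.prodMk hN).aemeasurable).1 hP.indep_transmitter
  rw [(indepFun_iff_map_prod_eq_prod_map_map hΘ.aemeasurable hN.aemeasurable).1
    hP.indep_fading_noise] at h1
  have h2 := (indepFun_iff_map_prod_eq_prod_map_map hA.aemeasurable hΘ.aemeasurable).1
    (hP.indep_transmitter.comp measurable_id measurable_fst)
  have hpA := Measure.isProbabilityMeasure_map (μ := P) hA.aemeasurable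
  have hpΘ := Measure.isProbabilityMeasure_map (μ := P) hΘ.aemeasurable
  have hpN := Measure.isProbabilityMeasure_map (μ := P) hN.aemeasurable
  rw [← Measure.prodAssoc_prod, ← h2] at h1
  set F : (Codebook M n × Fin M) × (ℤ → ℝ) × (Fin n → ℝ) →
    (Codebook M n × Fin M × (ℤ → ℝ)) × (Fin n → ℝ) :=
    fun z => ((z.1.1, z.1.2, z.2.1), z.2.2) with hF
  have hFm : Measurable F := by fun_prop
  have h3 := congrArg (Measure.map F) h1
  rw [Measure.map_map hFm (hA.prodMk (hΘ.prodMk hN)),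
    Measure.map_map hFm (MeasurableEquiv.measurable _)] at h3
  refine h3.trans ?_
  have h4 : F ∘ MeasurableEquiv.prodAssoc
      = Prod.map (MeasurableEquiv.prodAssoc : (Codebook M n × Fin M) × (ℤ → ℝ) ≃ᵐ _) id := rfl
  have hpAΘ := Measure.isProbabilityMeasure_map (μ := P) (hA.prodMk hΘ).aemeasurable
  rw [h4, ← Measure.map_prod_map _ _ (MeasurableEquiv.measurable _) measurable_id, Measure.map_id,
    Measure.map_map (MeasurableEquiv.measurable _) (hA.prodMk hΘ), hP.noise_law]
  rfl

theorem IsFadingChannel.measure_errorEvent [IsProbabilityMeasure P]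
    (hP : IsFadingChannel P σ A C m θ Y) (hθ : ∀ t, Measurable (θ t))
    (hdec : Measurable fun z : Codebook M n × (Fin n → ℝ) => dec z.1 z.2) :
    P (errorEvent dec C m Y)
      = ((P.map fun ω => (C ω, m ω, fun t : ℤ => θ t ω)).prod
        (Measure.pi fun _ : Fin n => gaussianReal 0 (σ ^ 2).toNNReal))
        {z | (z.1, z.2 + fadingShift z.1) ∈ plainErrorSet dec} := by
  have hS : MeasurableSet {z : (Codebook M n × Fin M × (ℤ → ℝ)) × (Fin n → ℝ) |
      (z.1, z.2 + fadingShift z.1) ∈ plainErrorSet dec} :=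
    (measurableSet_plainErrorSet hdec).preimage (measurable_fst.prodMk
      (measurable_snd.add (measurable_fadingShift.comp measurable_fst)))
  rw [← hP.map_transmitter_noise hθ, Measure.map_apply
    ((hP.measurable_transmitter hθ).prodMk (hP.measurable_fadingNoise hθ)) hS]
  congr 1
  ext ω
  have : fadingNoise C m θ Y ω + fadingShift (C ω, m ω, fun t : ℤ => θ t ω)
      + codeword (C ω, m ω, fun t : ℤ => θ t ω) = Y ω := by
    ext i
    simp only [fadingNoise, fadingShift, codeword, input, Pi.add_apply]
    ring
  simp only [errorEvent, plainErrorSet, Set.mem_preimage, Set.mem_ofPred_eq, this]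

/-- The error set here ignores the fading coordinate. Keeping that coordinate puts both error
probabilities on one product measure, where they differ only by the shift. -/
theorem IsNoFadingReference.measure_errorEvent [IsProbabilityMeasure P]
    (hQ : IsNoFadingReference P Q C m θ Y)
    (hP : IsFadingChannel P σ A C m θ Y) (hθ : ∀ t, Measurable (θ t))
    (hdec : Measurable fun z : Codebook M n × (Fin n → ℝ) => dec z.1 z.2) :
    Q (errorEvent dec C m Y)
      = ((P.map fun ω => (C ω, m ω, fun t : ℤ => θ t ω)).prod
        (Measure.pi fun _ : Fin n => gaussianReal 0 (σ ^ 2).toNNReal)) (plainErrorSet dec) := by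
  have hS := measurableSet_plainErrorSet hdec
  set F : Codebook M n × Fin M × (ℤ → ℝ) × (Fin n → ℝ) →
    (Codebook M n × Fin M × (ℤ → ℝ)) × (Fin n → ℝ) :=
    fun z => ((z.1, z.2.1, z.2.2.1), z.2.2.2) with hF
  have hFm : Measurable F := by fun_prop
  have hid := IdentDistrib.comp hQ hFm
  have h1 := hid.measure_preimage_eq hS
  have h2 := Measure.map_apply (μ := P) ((hP.measurable_transmitter hθ).prodMk
    (hP.measurable_fadingNoise hθ)) hS
  rw [hP.map_transmitter_noise hθ] at h2
  rw [h2]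
  refine Eq.trans ?_ h1
  congr 1
  ext ω
  have : plainNoise C m Y ω + codeword (C ω, m ω, fun t : ℤ => θ t ω) = Y ω := by
    ext i
    simp only [plainNoise, codeword, input, Pi.add_apply]
    ring
  simp only [errorEvent, plainErrorSet, Set.mem_preimage, Set.mem_ofPred_eq, Function.comp_apply,
    hF, this]

/-- The Rényi divergence factor is at most an exponential moment of the fading energy. -/
theorem IsFadingChannel.lintegral_exp_fadingShift_le
    (hP : IsFadingChannel P σ A C m θ Y) (hθ : ∀ t, Measurable (θ t)) {b c : ℝ} (hb : 0 ≤ b)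
    (hc : c = b * A ^ 2) :
    ∫⁻ t, ENNReal.ofReal (Real.exp (b * ∑ i, fadingShift t i ^ 2))
        ∂(P.map fun ω => (C ω, m ω, fun t : ℤ => θ t ω))
      ≤ ∫⁻ ω, ENNReal.ofReal (Real.exp (c * ∑ i : Fin n, θ ((i : ℕ) + 1 : ℤ) ω ^ 2)) ∂P := by
  have hs := measurable_fadingShift (M := M) (n := n)
  rw [lintegral_map (by fun_prop) (hP.measurable_transmitter hθ)]
  refine lintegral_mono_ae ?_
  filter_upwards [hP.amplitude] with ω hω
  refine ENNReal.ofReal_le_ofReal (Real.exp_le_exp.2 ?_)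
  rw [hc, mul_assoc, Finset.mul_sum (a := A ^ 2)]
  refine mul_le_mul_of_nonneg_left (Finset.sum_le_sum fun i _ => ?_) hb
  -- Passing through `|A|` avoids any sign condition on `A`.
  have h1 : input C m ω i ^ 2 ≤ A ^ 2 := sq_le_sq.2 ((hω i).trans (le_abs_self A))
  have h2 : fadingShift (C ω, m ω, fun t : ℤ => θ t ω) i = θ ((i : ℕ) + 1 : ℤ) ω * input C m ω i :=
    rfl
  rw [h2, mul_pow, mul_comm]
  exact mul_le_mul_of_nonneg_right h1 (sq_nonneg _)

theorem measure_errorEvent_le_and_ge [IsProbabilityMeasure P] (hσ : 0 < σ)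
    (hθ : ∀ t, Measurable (θ t))
    (hP : IsFadingChannel P σ A C m θ Y) (hQ : IsNoFadingReference P Q C m θ Y)
    (hdec : Measurable fun z : Codebook M n × (Fin n → ℝ) => dec z.1 z.2)
    {α c : ℝ} (hα : 1 < α) (hc : c = α * (α - 1) * A ^ 2 / (2 * σ ^ 2)) {K : ℝ≥0∞}
    (hK : ∫⁻ ω, ENNReal.ofReal (Real.exp (c * ∑ i : Fin n, θ ((i : ℕ) + 1 : ℤ) ω ^ 2)) ∂P ≤ K) :
    P (errorEvent dec C m Y) ≤ K ^ (1 / α) * Q (errorEvent dec C m Y) ^ ((α - 1) / α) ∧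
    Q (errorEvent dec C m Y) ≤ K ^ (1 / α) * P (errorEvent dec C m Y) ^ ((α - 1) / α) := by
  have hα0 : 0 < α := by linarith
  have hv : (σ ^ 2).toNNReal ≠ 0 := (Real.toNNReal_pos.2 (by positivity)).ne'
  have hvσ : ((σ ^ 2).toNNReal : ℝ) = σ ^ 2 := Real.coe_toNNReal _ (sq_nonneg σ)
  have hB := measurableSet_plainErrorSet hdec
  have hs := measurable_fadingShift (M := M) (n := n)
  have hB' : MeasurableSet {z : (Codebook M n × Fin M × (ℤ → ℝ)) × (Fin n → ℝ) |
      (z.1, z.2 + fadingShift z.1) ∈ plainErrorSet dec} :=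
    hB.preimage (measurable_fst.prodMk (measurable_snd.add (hs.comp measurable_fst)))
  have hT := Measure.isProbabilityMeasure_map (μ := P) (hP.measurable_transmitter hθ).aemeasurable
  have hK' := (hP.lintegral_exp_fadingShift_le hθ
    (b := α * (α - 1) / (2 * (σ ^ 2).toNNReal))
    (div_nonneg (mul_nonneg hα0.le (by linarith)) (by positivity))
    (c := c) (by rw [hc, hvσ]; ring)).trans hK
  rw [hP.measure_errorEvent hθ hdec, hQ.measure_errorEvent hP hθ hdec]
  constructor
  · refine (measure_gaussian_shift_le hv _ hs hB hα).trans ?_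
    gcongr
  -- Shifting the fading error set by `-h` gives back the error set without fading, and the moment
  -- depends only on `h²`.
  · have h := measure_gaussian_shift_le hv
      (P.map fun ω => (C ω, m ω, fun t : ℤ => θ t ω)) hs.neg hB' hα
    simp only [Set.mem_ofPred_eq, Pi.neg_apply, neg_sq, neg_add_cancel_right]
      at h
    refine h.trans ?_
    gcongr

end OneShot

/-! ### The bounds on the error exponents. -/

theorem mainTheorem2
    {Ω : Type*} [MeasurableSpace Ω]
    (P Q : Measure Ω) [IsProbabilityMeasure P] [IsProbabilityMeasure Q]
    (σ A : ℝ) (hσ : 0 < σ)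
    -- the fading process
    (θ : ℤ → Ω → ℝ) (hθ : IsStationaryGaussian P θ)
    (hr : Summable (fun k : ℤ => |autocov P θ k|))
    -- for each blocklength: codebook, message, channel output and decoder
    (M : ℕ → ℕ)
    (C : ∀ n, Ω → Codebook (M n) n) (m : ∀ n, Ω → Fin (M n)) (Y : ∀ n, Ω → Fin n → ℝ)
    (dec : ∀ n, Codebook (M n) n → (Fin n → ℝ) → Fin (M n))
    (hdec : ∀ n, Measurable (fun z : Codebook (M n) n × (Fin n → ℝ) => dec n z.1 z.2))
    -- the two channels
    (hP : ∀ n, IsFadingChannel P σ A (C n) (m n) θ (Y n))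
    (hQ : ∀ n, IsNoFadingReference P Q (C n) (m n) θ (Y n))
    (α c : ℝ) (hα : 1 < α) (hc : c = α * (α - 1) * A ^ 2 / (2 * σ ^ 2))
    (hsup : 2 * c * (⨆ lam : ℝ, spectralDensity (autocov P θ) lam) < 1) :
    let J : ℝ := ∫ lam in (0 : ℝ)..(2 * Real.pi),
      Real.log (1 - 2 * c * spectralDensity (autocov P θ) lam)
    let p : ℕ → ℝ≥0∞ := fun n => P (errorEvent (dec n) (C n) (m n) (Y n))
    let q : ℕ → ℝ≥0∞ := fun n => Q (errorEvent (dec n) (C n) (m n) (Y n))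
    (upperExponent p ≤ ((α / (α - 1) : ℝ) : EReal) * upperExponent q
        + ((-(1 / (4 * Real.pi * (α - 1))) * J : ℝ) : EReal)) ∧
    (lowerExponent p ≤ ((α / (α - 1) : ℝ) : EReal) * lowerExponent q
        + ((-(1 / (4 * Real.pi * (α - 1))) * J : ℝ) : EReal)) ∧
    (((α - 1) / α : ℝ) : EReal) * lowerExponent q
        + ((1 / (4 * Real.pi * α) * J : ℝ) : EReal) ≤ lowerExponent p ∧
    (((α - 1) / α : ℝ) : EReal) * upperExponent q
        + ((1 / (4 * Real.pi * α) * J : ℝ) : EReal) ≤ upperExponent p := by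
  intro J p q
  have hα0 : 0 < α := by linarith
  have hα1 : 0 < α - 1 := by linarith
  have hc0 : 0 ≤ c := by
    rw [hc]
    positivity
  -- Boundedness of the spectral density, from absolute summability, makes the real supremum a
  -- genuine upper bound.
  have hpos (x : ℝ) : 0 < 1 - 2 * c * spectralDensity (autocov P θ) x := by
    have h := mul_le_mul_of_nonneg_left (le_ciSup (bddAbove_spectralDensity hr) x)
      (show 0 ≤ 2 * c by linarith)
    linarith
  have hone (n : ℕ) := measure_errorEvent_le_and_ge hσ hθ.measurable (hP n) (hQ n) (hdec n) hα hc
    (hθ.lintegral_exp_mul_sum_sq_le hr hc0 hpos n)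
  -- Exposes the moment bound as `exp(-(n κ))` with `κ = J / (4π)`.
  simp only [mul_assoc (_ : ℝ) (4 * Real.pi)⁻¹] at hone
  obtain ⟨h3, h4⟩ := exponents_ge_of_le (p := p) (q := q) hα fun n => (hone n).1
  obtain ⟨h2, h1⟩ := exponents_ge_of_le (p := q) (q := p) hα fun n => (hone n).2
  have hJ : (4 * Real.pi)⁻¹ * J / α = 1 / (4 * Real.pi * α) * J := by
    field_simp
  have hJ' : -(((α - 1) / α)⁻¹ * ((4 * Real.pi)⁻¹ * J / α))
      = -(1 / (4 * Real.pi * (α - 1))) * J := by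
    field_simp
  have hb : 0 < (α - 1) / α := by positivity
  -- The bounds with `P` and `Q` exchanged, solved for the exponents of `P`.
  have h1' := EReal.le_inv_mul_add hb h1
  have h2' := EReal.le_inv_mul_add hb h2
  rw [hJ', inv_div] at h1' h2'
  rw [hJ] at h3 h4
  exact ⟨h1', h2', h3, h4⟩
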